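/- For real $q\ge 1$, $\gamma\in\mathbb R$ and $c>1$ put $\Phi_{q,\gamma,c}(u)=|u|^q[\log(c+|u|)]^{\gamma}$. Call $\Phi:\mathbb R\to\mathbb R$ an Orlicz function if it is even and convex, $\Phi(0)=0$ and $\Phi(u)>0$ for $u\neq0$. For $\Delta>0$ and an Orlicz function $\Phi$ let $$\|h\|_{L(\Phi)}=\inf_{v>0}\frac1v\Bigl[1+\int_0^\Delta\Phi(v\,h(x))\,dx\Bigr],\qquad \phi(L(\Phi),\Delta)=\sup_{A\subseteq(0,\Delta)}\|\mathbf 1_A\|_{L(\Phi)}\quad(A\text{ measurable})$$ be the Orlicz norm over $(0,\Delta)$ and the value at $\Delta$ of the fundamental function. Put $(T_\Delta f)(x)=f(x/\Delta)$. For integers $n\ge1$ and $0\le k\le n$ let $Z(n,k)$ be the set of all $f:[0,1]\to\mathbb R$ of class $C^{n-1}$ with $f^{(n-1)}$ absolutely continuous such that $f^{(i)}(0)=0$ for $0\le i<k$ and $f^{(j)}(1)=0$ for $0\le j<n-k$; $f^{(n)}$ denotes the almost everywhere defined $n$-th derivative. **Theorem 5.1.** Let $1<p<\infty$, $1\le q<\infty$,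 $\gamma,\beta\ge0$, $n\ge1$, $0\le k\le n$. For all sufficiently large $c$ both $\Phi_{q,\gamma,c}$ and $\Phi_{p,-\beta,c}$ are Orlicz functions. Whenever $c_X,c_Y>1$ are constants for which $\Phi_{q,\gamma,c_X}$ and $\Phi_{p,-\beta,c_Y}$ are Orlicz functions, the Zygmund spaces $X=L_q(\mathrm{Log})^{\gamma}L$ and $Y=L_p(\mathrm{Log})^{-\beta}L$ over $(0,\Delta)$ that they generate satisfy $$\sup_{\Delta\in(0,\infty)}W^{o}(\Delta;p,q;n,k)<\infty,\qquad W^{o}(\Delta;p,q;n,k)=\sup_{f\in Z(n,k),\ f^{(n)}\ne0}\left[\frac{\|T_\Delta f\|_X}{\phi(X,\Delta)}:\frac{\Delta^n\,\|(T_\Delta f)^{(n)}\|_Y}{\phi(Y,\Delta)}\right],$$ where $f^{(n)}\neq 0$ means that $f^{(n)}$ is not almost everywhere zero, and the quotient is $0$ if $\|(T_\Delta f)^{(n)}\|_Y=\infty$. In other words, there is a finite constant $C$, independent of $\Delta$ and $f$, with $$\frac{\|T_\Delta f\|_X}{\phi(X,\Delta)}\le C\,\frac{\Delta^n\,\|(T_\Delta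 f)^{(n)}\|_Y}{\phi(Y,\Delta)}\qquad\text{for all }\Delta>0,\ f\in Z(n,k)$$ (the right-hand side is understood as $+\infty$ if $\|(T_\Delta f)^{(n)}\|_Y=\infty$). -/

import Mathlib

open MeasureTheory Set
open scoped ENNReal NNReal

noncomputable section

namespace Wirtinger

/-- `Φ` is an Orlicz (Young) function: finite, even, convex, and vanishing exactly at `0`.
(Continuity and `Φ u → ∞` as `|u| → ∞` follow.) -/
structure IsOrliczFunction (Φ : ℝ → ℝ) : Prop where
  even : ∀ u, Φ (-u) = Φ u
  convex : ConvexOn ℝ univ Φ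
  zero : Φ 0 = 0
  pos : ∀ u, u ≠ 0 → 0 < Φ u

/-- The function `Φ(u) = |u|^q [log (c + |u|)]^γ` that generates the generalized Zygmund space
`L_q (Log)^γ L`; the exponent `γ` is a real number of any sign. -/
def zygmund (q γ c : ℝ) (u : ℝ) : ℝ := |u| ^ q * Real.log (c + |u|) ^ γ

/-- The Orlicz norm `‖h‖ = inf_{v > 0} v⁻¹ [1 + ∫_0^Δ Φ(v h(x)) dx]` over the interval `(0, Δ)`
with Lebesgue measure. Its value is `∞` when `h` is outside the Orlicz space. -/
def orliczNorm (Φ : ℝ → ℝ) (Δ : ℝ) (h : ℝ → ℝ) : ℝ≥0∞ :=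
  ⨅ (v : ℝ) (_ : 0 < v),
    ENNReal.ofReal v⁻¹ * (1 + ∫⁻ x in Ioo 0 Δ, ENNReal.ofReal (Φ (v * h x)))

/-- The fundamental function of the Orlicz space over `(0, Δ)`: the supremum of the norms of the
indicators of the measurable sets `A ⊆ (0, Δ)` of measure at most `δ`. -/
def fundamentalFunction (Φ : ℝ → ℝ) (Δ δ : ℝ) : ℝ≥0∞ :=
  ⨆ (A : Set ℝ) (_ : MeasurableSet A) (_ : A ⊆ Ioo 0 Δ) (_ : volume A ≤ ENNReal.ofReal δ),
    orliczNorm Φ Δ (A.indicator 1)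

/-- The normalized norm `R(h; X, Δ) = ‖h‖_X / φ(X, Δ)` over `(0, Δ)`. -/
def normalizedNorm (Φ : ℝ → ℝ) (Δ : ℝ) (h : ℝ → ℝ) : ℝ≥0∞ :=
  orliczNorm Φ Δ h / fundamentalFunction Φ Δ Δ

/-- The dilation `(T_θ f)(x) = f(x / θ)`. -/
def dilation (θ : ℝ) (f : ℝ → ℝ) : ℝ → ℝ := fun x => f (x / θ)

/-- The generalized `n`-th derivative on `[a, b]`. For `f` as in `zeroClass` it is the almost
everywhere defined derivative of the absolutely continuous function `f^{(n-1)}`, which is the weak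
`n`-th derivative of `f` (the value is `0` at the null set of points where it does not exist). -/
def nthDeriv (n : ℕ) (a b : ℝ) (f : ℝ → ℝ) : ℝ → ℝ := iteratedDerivWithin n f (Icc a b)

/-- The class `Z(n, k)` on `[a, b]` (for `1 ≤ n`): functions with an integrable generalized `n`-th
derivative on `[a, b]`, that is, `f ∈ C^{n-1}[a, b]` with `f^{(n-1)}` absolutely continuous, that
have a `k`-fold zero at `a` and an `(n - k)`-fold zero at `b`. Values outside `[a, b]` play
no role. -/
structure zeroClass (n k : ℕ) (a b : ℝ) (f : ℝ → ℝ) : Prop where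
  contDiffOn : ContDiffOn ℝ ((n - 1 : ℕ) : WithTop ℕ∞) f (Icc a b)
  absCont : AbsolutelyContinuousOnInterval (nthDeriv (n - 1) a b f) a b
  zero_left : ∀ i < k, nthDeriv i a b f a = 0
  zero_right : ∀ j < n - k, nthDeriv j a b f b = 0

/-- The dilation-normalized Wirtinger functional
`W°(Δ) = sup_f (‖T_Δ f‖_X / φ(X, Δ)) : (Δ^n ‖(T_Δ f)^{(n)}‖_Y / φ(Y, Δ))` of the Orlicz spaces
`X`, `Y` generated by `Φ`, `Ψ`; the supremum is over all `f ∈ Z(n, k)` on `[0, 1]` whose `n`-th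
derivative is not almost everywhere zero. -/
def wirtingerFunctional (Φ Ψ : ℝ → ℝ) (n k : ℕ) (Δ : ℝ) : ℝ≥0∞ :=
  ⨆ (f : ℝ → ℝ) (_ : zeroClass n k 0 1 f)
    (_ : ¬ nthDeriv n 0 1 f =ᵐ[volume.restrict (Ioo 0 1)] 0),
    normalizedNorm Φ Δ (dilation Δ f) /
      (ENNReal.ofReal (Δ ^ n) * normalizedNorm Ψ Δ (nthDeriv n 0 Δ (dilation Δ f)))

end Wirtinger

end

/-! The inequality holds with constant 1 for any two Orlicz functions. Since `φ(X, Δ)` is the norm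
of the constant 1, the normalized norm of `h` lies between the mean of `|h|` over `(0, Δ)` (Jensen,
`average_le_normalizedNorm`) and any bound for `|h|` there (`normalizedNorm_le_of_abs_le`). So only
sup of `|f|` ≤ `∫ |f^{(n)}|` on `[0, 1]` is needed: by Rolle every derivative of order below `n`
vanishes somewhere, and integrating `n` times from such zeros gives `abs_le_integral`. Under
dilation, `Δ^n` cancels the chain-rule factor, so the mean is independent of `Δ`. The Zygmund form
matters only for convexity when `c` is large. -/

namespace Wirtinger

/-! ### Elementary properties of Orlicz functions -/

namespace IsOrliczFunction

variable {Φ : ℝ → ℝ}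

theorem nonneg (h : IsOrliczFunction Φ) (u : ℝ) : 0 ≤ Φ u := by
  rcases eq_or_ne u 0 with rfl | hu
  · exact h.zero.ge
  · exact (h.pos u hu).le

theorem abs_eq (h : IsOrliczFunction Φ) (u : ℝ) : Φ |u| = Φ u := by
  rcases abs_choice u with hu | hu <;> rw [hu]
  exact h.even u

theorem map_mul_le (h : IsOrliczFunction Φ) {t : ℝ} (ht : 0 ≤ t) (ht1 : t ≤ 1) (u : ℝ) :
    Φ (t * u) ≤ t * Φ u := by
  have := h.convex.2 (mem_univ u) (mem_univ 0) ht (sub_nonneg.2 ht1) (by ring)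
  simpa [h.zero] using this

theorem mono_abs (h : IsOrliczFunction Φ) {u w : ℝ} (huw : |u| ≤ |w|) : Φ u ≤ Φ w := by
  rw [← h.abs_eq u, ← h.abs_eq w]
  rcases (abs_nonneg w).eq_or_lt with hw | hw
  · rw [← hw] at huw ⊢
    rw [le_antisymm huw (abs_nonneg u)]
  · have ht1 : |u| / |w| ≤ 1 := (div_le_one hw).2 huw
    calc Φ |u| = Φ (|u| / |w| * |w|) := by rw [div_mul_cancel₀ _ hw.ne']
      _ ≤ |u| / |w| * Φ |w| := h.map_mul_le (by positivity) ht1 _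
      _ ≤ Φ |w| := mul_le_of_le_one_left (h.nonneg _) ht1

theorem continuous (h : IsOrliczFunction Φ) : Continuous Φ :=
  continuousOn_univ.1 (h.convex.continuousOn isOpen_univ)

end IsOrliczFunction

/-! ### Orlicz norms between mean and supremum -/

variable {Φ : ℝ → ℝ} {Δ : ℝ}

theorem orliczNorm_le (Φ : ℝ → ℝ) (Δ : ℝ) (h : ℝ → ℝ) {v : ℝ} (hv : 0 < v) :
    orliczNorm Φ Δ h ≤
      ENNReal.ofReal v⁻¹ * (1 + ∫⁻ x in Ioo 0 Δ, ENNReal.ofReal (Φ (v * h x))) :=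
  iInf₂_le v hv

theorem IsOrliczFunction.orliczNorm_mono (hΦ : IsOrliczFunction Φ) {h₁ h₂ : ℝ → ℝ}
    (h : ∀ x ∈ Ioo 0 Δ, |h₁ x| ≤ |h₂ x|) : orliczNorm Φ Δ h₁ ≤ orliczNorm Φ Δ h₂ := by
  refine iInf₂_mono fun v hv => ?_
  refine mul_le_mul' le_rfl (add_le_add le_rfl ?_)
  refine setLIntegral_mono' measurableSet_Ioo fun x hx => ENNReal.ofReal_le_ofReal ?_
  apply hΦ.mono_abs
  rw [abs_mul, abs_mul]
  exact mul_le_mul_of_nonneg_left (h x hx) (abs_nonneg v)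

theorem IsOrliczFunction.orliczNorm_zero (hΦ : IsOrliczFunction Φ) :
    orliczNorm Φ Δ (fun _ => 0) = 0 := by
  refine le_antisymm (ENNReal.le_of_forall_pos_le_add fun ε hε _ => ?_) zero_le
  have := orliczNorm_le Φ Δ (fun _ => 0) (v := (ε : ℝ)⁻¹) (by positivity)
  simpa [hΦ.zero] using this

theorem ofReal_mul_inv_cancel {m v : ℝ} (hm : 0 < m) :
    ENNReal.ofReal m * ENNReal.ofReal (v * m)⁻¹ = ENNReal.ofReal v⁻¹ := by
  rw [← ENNReal.ofReal_mul hm.le]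
  congr 1
  rw [mul_inv]
  field_simp

theorem IsOrliczFunction.orliczNorm_const_le (hΦ : IsOrliczFunction Φ) {m : ℝ} (hm : 0 ≤ m) :
    orliczNorm Φ Δ (fun _ => m) ≤ ENNReal.ofReal m * orliczNorm Φ Δ (fun _ => 1) := by
  rcases hm.eq_or_lt with rfl | hm
  · simp [hΦ.orliczNorm_zero]
  · simp_rw [orliczNorm]
    rw [ENNReal.mul_iInf_of_ne (by simpa using hm) ENNReal.ofReal_ne_top]
    refine le_iInf fun v => ?_
    rw [ENNReal.mul_iInf_of_ne (by simpa using hm) ENNReal.ofReal_ne_top]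
    refine le_iInf fun hv => ?_
    refine (iInf₂_le (v / m) (by positivity)).trans_eq ?_
    rw [← mul_assoc, ← ofReal_mul_inv_cancel (v := v / m) hm, div_mul_cancel₀ _ hm.ne', mul_one]

theorem orliczNorm_one_le_fundamentalFunction (Φ : ℝ → ℝ) (Δ : ℝ) :
    orliczNorm Φ Δ (fun _ => 1) ≤ fundamentalFunction Φ Δ Δ := by
  have h : orliczNorm Φ Δ (fun _ => 1) = orliczNorm Φ Δ ((Ioo 0 Δ).indicator 1) := by
    simp_rw [orliczNorm]
    refine iInf_congr fun v => iInf_congr fun hv => ?_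
    congr 2
    refine setLIntegral_congr_fun measurableSet_Ioo fun x hx => ?_
    simp [indicator_of_mem hx]
  rw [h]
  exact le_iSup₂_of_le (Ioo 0 Δ) measurableSet_Ioo
    (le_iSup₂_of_le subset_rfl (by simp) le_rfl)

theorem IsOrliczFunction.fundamentalFunction_le (hΦ : IsOrliczFunction Φ) (δ : ℝ) :
    fundamentalFunction Φ Δ δ ≤ orliczNorm Φ Δ (fun _ => 1) := by
  refine iSup₂_le fun A _ => iSup₂_le fun _ _ => hΦ.orliczNorm_mono fun x _ => ?_
  by_cases hx : x ∈ A <;> simp [hx]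

theorem orliczNorm_one_ne_top (Φ : ℝ → ℝ) (Δ : ℝ) : orliczNorm Φ Δ (fun _ => 1) ≠ ∞ := by
  refine ((orliczNorm_le Φ Δ _ one_pos).trans_lt ?_).ne
  simp [ENNReal.mul_lt_top_iff]

theorem IsOrliczFunction.orliczNorm_one_pos (hΦ : IsOrliczFunction Φ) (hΔ : 0 < Δ) :
    0 < orliczNorm Φ Δ (fun _ => 1) := by
  have hc : 0 < min 1 (Φ 1 * Δ) := lt_min one_pos (mul_pos (hΦ.pos 1 one_ne_zero) hΔ)
  refine (ENNReal.ofReal_pos.2 hc).trans_le (le_iInf₂ fun v hv => ?_)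
  have hnn := hΦ.nonneg v
  have hrw : ENNReal.ofReal v⁻¹ * (1 + ∫⁻ _ in Ioo 0 Δ, ENNReal.ofReal (Φ (v * 1))) =
      ENNReal.ofReal (v⁻¹ * (1 + Φ v * Δ)) := by
    rw [ENNReal.ofReal_mul (by positivity), ENNReal.ofReal_add zero_le_one (by positivity),
      ENNReal.ofReal_mul hnn]
    simp
  rw [hrw]
  apply ENNReal.ofReal_le_ofReal
  rw [inv_mul_eq_div, le_div_iff₀ hv]
  -- For `v ≤ 1` the summand 1 suffices; for `v ≥ 1` convexity gives `v * Φ 1 ≤ Φ v`.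
  rcases le_total v 1 with h | h
  · calc min 1 (Φ 1 * Δ) * v ≤ 1 * 1 := by gcongr; exact min_le_left _ _
      _ ≤ 1 + Φ v * Δ := by nlinarith [mul_nonneg hnn hΔ.le]
  · have h1 := hΦ.map_mul_le (t := v⁻¹) (by positivity) (inv_le_one_of_one_le₀ h) v
    rw [inv_mul_cancel₀ hv.ne', inv_mul_eq_div, le_div_iff₀ hv] at h1
    calc min 1 (Φ 1 * Δ) * v ≤ Φ 1 * Δ * v := by gcongr; exact min_le_right _ _
      _ ≤ 1 + Φ v * Δ := by nlinarith

/-- The normalized norm is dominated by the supremum norm. -/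
theorem IsOrliczFunction.normalizedNorm_le_of_abs_le (hΦ : IsOrliczFunction Φ) {h : ℝ → ℝ}
    {M : ℝ} (hM : 0 ≤ M) (hh : ∀ x ∈ Ioo 0 Δ, |h x| ≤ M) :
    normalizedNorm Φ Δ h ≤ ENNReal.ofReal M := by
  refine ENNReal.div_le_of_le_mul ?_
  calc orliczNorm Φ Δ h ≤ orliczNorm Φ Δ (fun _ => M) :=
        hΦ.orliczNorm_mono fun x hx => (hh x hx).trans (le_abs_self M)
    _ ≤ ENNReal.ofReal M * orliczNorm Φ Δ (fun _ => 1) := hΦ.orliczNorm_const_le hM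
    _ ≤ _ := by gcongr; exact orliczNorm_one_le_fundamentalFunction Φ Δ

/-- Jensen's inequality for a lower Lebesgue integral. -/
theorem IsOrliczFunction.map_average_le_setLIntegral (hΦ : IsOrliczFunction Φ) (hΔ : 0 < Δ)
    {h : ℝ → ℝ} (hh : IntegrableOn h (Ioo 0 Δ)) :
    ENNReal.ofReal (Δ * Φ (Δ⁻¹ * ∫ x in Ioo 0 Δ, |h x|)) ≤
      ∫⁻ x in Ioo 0 Δ, ENNReal.ofReal (Φ (h x)) := by
  by_cases hfin : ∫⁻ x in Ioo 0 Δ, ENNReal.ofReal (Φ (h x)) = ∞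
  · rw [hfin]; exact le_top
  have hmeas : AEStronglyMeasurable (fun x => Φ (h x)) (volume.restrict (Ioo 0 Δ)) :=
    hΦ.continuous.comp_aestronglyMeasurable hh.aestronglyMeasurable
  have hint : IntegrableOn (fun x => Φ (h x)) (Ioo 0 Δ) :=
    (lintegral_ofReal_ne_top_iff_integrable hmeas (.of_forall fun x => hΦ.nonneg _)).1 hfin
  rw [← ofReal_integral_eq_lintegral_ofReal hint (.of_forall fun x => hΦ.nonneg _)]
  apply ENNReal.ofReal_le_ofReal
  have : NeZero (volume.restrict (Ioo 0 Δ)) := ⟨by simp [hΔ]⟩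
  have key := hΦ.convex.map_average_le (μ := volume.restrict (Ioo 0 Δ)) (f := fun x => |h x|)
    hΦ.continuous.continuousOn isClosed_univ (by simp) hh.abs
    (by simpa only [Function.comp_def, hΦ.abs_eq] using hint.integrable)
  simp_rw [hΦ.abs_eq, average_eq, measureReal_restrict_apply_univ, Real.volume_real_Ioo,
    sub_zero, max_eq_left hΔ.le, smul_eq_mul] at key
  rwa [inv_mul_eq_div Δ (∫ x in Ioo 0 Δ, Φ (h x)), le_div_iff₀' hΔ] at key

/-- The normalized norm dominates the mean value. -/
theorem IsOrliczFunction.average_le_normalizedNorm (hΦ : IsOrliczFunction Φ) (hΔ : 0 < Δ)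
    {h : ℝ → ℝ} (hh : IntegrableOn h (Ioo 0 Δ)) :
    ENNReal.ofReal (Δ⁻¹ * ∫ x in Ioo 0 Δ, |h x|) ≤ normalizedNorm Φ Δ h := by
  have hφ : fundamentalFunction Φ Δ Δ = orliczNorm Φ Δ (fun _ => 1) :=
    (hΦ.fundamentalFunction_le Δ).antisymm (orliczNorm_one_le_fundamentalFunction Φ Δ)
  rw [normalizedNorm, hφ, ENNReal.le_div_iff_mul_le (.inl (hΦ.orliczNorm_one_pos hΔ).ne')
    (.inl (orliczNorm_one_ne_top Φ Δ))]
  set m := Δ⁻¹ * ∫ x in Ioo 0 Δ, |h x| with hm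
  have hm0 : 0 ≤ m := mul_nonneg (by positivity) (integral_nonneg fun x => abs_nonneg _)
  rcases hm0.eq_or_lt with hm0 | hm0
  · simp [← hm0]
  refine le_iInf₂ fun v hv => ?_
  -- The parameter `v` for `h` is matched by `v * m` for the constant 1, so that Jensen compares the
  -- two integrals.
  calc ENNReal.ofReal m * orliczNorm Φ Δ (fun _ => 1)
      ≤ ENNReal.ofReal m * (ENNReal.ofReal (v * m)⁻¹ *
          (1 + ∫⁻ _ in Ioo 0 Δ, ENNReal.ofReal (Φ (v * m * 1)))) := by
        gcongr; exact orliczNorm_le Φ Δ _ (by positivity)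
    _ = ENNReal.ofReal v⁻¹ * (1 + ENNReal.ofReal (Δ * Φ (v * m))) := by
        rw [← mul_assoc, ofReal_mul_inv_cancel hm0, ENNReal.ofReal_mul hΔ.le]
        simp [mul_comm]
    _ ≤ _ := by
        have hvm : v * m = Δ⁻¹ * ∫ x in Ioo 0 Δ, |v * h x| := by
          simp_rw [abs_mul, abs_of_pos hv, integral_const_mul, hm]
          ring
        rw [hvm]
        gcongr
        exact hΦ.map_average_le_setLIntegral hΔ (hh.const_mul v)

/-! ### Convexity of the Zygmund functions -/

theorem hasDerivAt_rpow_mul_log_rpow (q γ : ℝ) {c u : ℝ} (hc : 1 < c) (hu : 0 < u) :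
    HasDerivAt (fun u => u ^ q * Real.log (c + u) ^ γ)
      (q * u ^ (q - 1) * Real.log (c + u) ^ γ +
        u ^ q * (γ * Real.log (c + u) ^ (γ - 1) * (c + u)⁻¹)) u := by
  have hL : 0 < Real.log (c + u) := Real.log_pos (by linarith)
  have h1 : HasDerivAt (fun u => c + u) 1 u := (hasDerivAt_id u).const_add c
  have h2 := ((h1.log (by linarith)).rpow_const (p := γ) (.inl hL.ne'))
  have h3 := (Real.hasDerivAt_rpow_const (p := q) (.inl hu.ne')).mul h2
  refine h3.congr_deriv ?_
  rw [one_div]; ring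

/-- With `L = log (c + u)` and `s = u / (c + u)`, the second derivative is `u^(q-2) L^(γ-2)` times
the quadratic expression in `h`. -/
theorem convexOn_rpow_mul_log_rpow {q γ c : ℝ} (hq : 1 ≤ q) (hc : 1 < c)
    (h : ∀ L s : ℝ, Real.log c ≤ L → 0 < s → s < 1 →
      0 ≤ q * (q - 1) * L ^ 2 + 2 * q * γ * s * L + γ * (γ - 1) * s ^ 2 - γ * s ^ 2 * L) :
    ConvexOn ℝ (Ici 0) (fun u => u ^ q * Real.log (c + u) ^ γ) := by
  have hLpos : ∀ u, 0 ≤ u → 0 < Real.log (c + u) := fun u hu => Real.log_pos (by linarith)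
  refine convexOn_of_hasDerivWithinAt2_nonneg (convex_Ici 0)
    (f' := fun u => q * (u ^ (q - 1) * Real.log (c + u) ^ γ) +
        γ * ((u ^ q * Real.log (c + u) ^ (γ - 1)) * (c + u)⁻¹))
    (f'' := fun u => q * ((q - 1) * u ^ (q - 1 - 1) * Real.log (c + u) ^ γ +
        u ^ (q - 1) * (γ * Real.log (c + u) ^ (γ - 1) * (c + u)⁻¹)) +
        γ * ((q * u ^ (q - 1) * Real.log (c + u) ^ (γ - 1) +
        u ^ q * ((γ - 1) * Real.log (c + u) ^ (γ - 1 - 1) * (c + u)⁻¹)) * (c + u)⁻¹ +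
        (u ^ q * Real.log (c + u) ^ (γ - 1)) * (-1 / (c + u) ^ 2)))
    ?_ ?_ ?_ ?_
  · refine ContinuousOn.mul (fun u hu => ?_) (ContinuousOn.rpow_const (ContinuousOn.log
      (by fun_prop) fun u hu => ?_) fun u hu => .inl (hLpos u hu).ne')
    · exact (Real.continuousAt_rpow_const u q (.inr (by linarith))).continuousWithinAt
    · have : (0 : ℝ) ≤ u := hu
      linarith
  · intro u hu
    rw [interior_Ici] at hu
    refine ((hasDerivAt_rpow_mul_log_rpow q γ hc hu).congr_deriv ?_).hasDerivWithinAt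
    ring
  · intro u hu
    rw [interior_Ici] at hu
    have hu : 0 < u := hu
    have h1 : HasDerivAt (fun u => (c + u)⁻¹) (-1 / (c + u) ^ 2) u :=
      ((hasDerivAt_id u).const_add c).inv (by simp only [id]; linarith)
    exact (((hasDerivAt_rpow_mul_log_rpow (q - 1) γ hc hu).const_mul q).add
      (((hasDerivAt_rpow_mul_log_rpow q (γ - 1) hc hu).mul h1).const_mul γ)).hasDerivWithinAt
  · intro u hu
    rw [interior_Ici] at hu
    have hu : 0 < u := hu
    have hL := hLpos u hu.le
    have hcu : 0 < c + u := by linarith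
    have key := h (Real.log (c + u)) (u / (c + u)) (Real.log_le_log (by linarith) (by linarith))
      (by positivity) ((div_lt_one hcu).2 (by linarith))
    set L := Real.log (c + u)
    have e1 : u ^ q = u ^ (q - 1 - 1) * u ^ 2 := by
      rw [← Real.rpow_natCast, ← Real.rpow_add hu]; congr 1; push_cast; ring
    have e2 : u ^ (q - 1) = u ^ (q - 1 - 1) * u := by
      rw [← Real.rpow_add_one hu.ne']; norm_num
    have e3 : L ^ γ = L ^ (γ - 1 - 1) * L ^ 2 := by
      rw [← Real.rpow_natCast, ← Real.rpow_add hL]; congr 1; push_cast; ring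
    have e4 : L ^ (γ - 1) = L ^ (γ - 1 - 1) * L := by
      rw [← Real.rpow_add_one hL.ne']; norm_num
    have e5 : 0 ≤ u ^ (q - 1 - 1) * L ^ (γ - 1 - 1) := by positivity
    rw [e1, e2, e3, e4]
    refine (mul_nonneg e5 key).trans_eq ?_
    field_simp
    ring

theorem isOrliczFunction_zygmund {q γ c : ℝ} (hq : 1 ≤ q) (hc : 1 < c)
    (h : ∀ L s : ℝ, Real.log c ≤ L → 0 < s → s < 1 →
      0 ≤ q * (q - 1) * L ^ 2 + 2 * q * γ * s * L + γ * (γ - 1) * s ^ 2 - γ * s ^ 2 * L) :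
    IsOrliczFunction (zygmund q γ c) := by
  have hconv := convexOn_rpow_mul_log_rpow hq hc h
  have hLpos : ∀ u, 0 ≤ u → 0 < Real.log (c + u) := fun u hu => Real.log_pos (by linarith)
  have h0 : (0 : ℝ) ^ q = 0 := Real.zero_rpow (by linarith)
  have hmono : MonotoneOn (fun u => u ^ q * Real.log (c + u) ^ γ) (Ici 0) := by
    intro u hu w hw huw
    have hu : 0 ≤ u := hu
    rcases hu.eq_or_lt with rfl | hu
    · have := Real.rpow_nonneg (hLpos w hw).le γ
      have := Real.rpow_nonneg (show 0 ≤ w from hw) q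
      simp only [h0, zero_mul]
      positivity
    · refine hconv.le_right_of_left_le'' self_mem_Ici hw hu huw ?_
      have := hLpos u hu.le
      simp only [h0, zero_mul]
      positivity
  refine ⟨fun u => by simp [zygmund], ⟨convex_univ, fun u _ w _ a b ha hb hab => ?_⟩,
    by simp [zygmund, h0], fun u hu => ?_⟩
  · simp only [zygmund]
    have h1 : |a • u + b • w| ≤ a • |u| + b • |w| := by
      simpa [abs_mul, abs_of_nonneg ha, abs_of_nonneg hb] using abs_add_le (a * u) (b * w)
    exact (hmono (mem_Ici.2 (abs_nonneg _)) (mem_Ici.2 ((abs_nonneg _).trans h1)) h1).trans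
      (hconv.2 (mem_Ici.2 (abs_nonneg u)) (mem_Ici.2 (abs_nonneg w)) ha hb hab)
  · have := hLpos |u| (abs_nonneg u)
    have := abs_pos.2 hu
    simp only [zygmund]
    positivity

theorem isOrliczFunction_zygmund_of_nonneg {q γ c : ℝ} (hq : 1 ≤ q) (hγ : 0 ≤ γ)
    (hc : Real.exp 1 ≤ c) : IsOrliczFunction (zygmund q γ c) := by
  have hc1 : 1 < c := (Real.one_lt_exp_iff.2 one_pos).trans_le hc
  refine isOrliczFunction_zygmund hq hc1 fun L s hL hs hs1 => ?_
  have hL1 : 1 ≤ L := ((Real.le_log_iff_exp_le (by linarith)).2 hc).trans hL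
  have h1 : 0 ≤ q * (q - 1) * L ^ 2 := by
    have := sub_nonneg.2 hq
    positivity
  have h2 : 0 ≤ γ * s * (2 * q * L - s - s * L) :=
    mul_nonneg (by positivity) (by nlinarith)
  nlinarith [mul_nonneg (mul_nonneg hγ hγ) (sq_nonneg s)]

/-- The only negative term, `-2pβsL`, is absorbed by `p(p-1)L²` once `L ≥ 2β/(p-1)`. -/
theorem isOrliczFunction_zygmund_neg {p β c : ℝ} (hp : 1 < p) (hβ : 0 ≤ β) (hc1 : 1 < c)
    (hc : Real.exp (2 * β / (p - 1)) ≤ c) : IsOrliczFunction (zygmund p (-β) c) := by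
  refine isOrliczFunction_zygmund hp.le hc1 fun L s hL hs hs1 => ?_
  have hL0 : 0 < L := (Real.log_pos hc1).trans_le hL
  have hL1 : 2 * β / (p - 1) ≤ L := ((Real.le_log_iff_exp_le (by linarith)).2 hc).trans hL
  rw [div_le_iff₀ (by linarith)] at hL1
  have h1 : 0 ≤ p * L * ((p - 1) * L - 2 * β * s) := by
    have : 2 * β * s ≤ 2 * β := mul_le_of_le_one_right (by positivity) hs1.le
    exact mul_nonneg (by positivity) (by linarith)
  have h2 : 0 ≤ β * (β + 1) * s ^ 2 + β * s ^ 2 * L := by positivity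
  linarith

/-! ### Zeros of derivatives and the bound by the `L¹` norm -/

/-- Rolle's theorem for several zeros: the derivative has at most one zero less. -/
theorem exists_finset_zeros_deriv {g g' : ℝ → ℝ} {a b : ℝ} (hg : ContinuousOn g (Icc a b))
    (hg' : ∀ x ∈ Ioo a b, HasDerivAt g (g' x) x) (T : Finset ℝ)
    (hT : ∀ x ∈ T, x ∈ Icc a b ∧ g x = 0) :
    ∃ S : Finset ℝ, T.card ≤ S.card + 1 ∧ ∀ x ∈ S, x ∈ Ioo a b ∧ g' x = 0 := by
  -- Keeping each old zero below some point of `T` ensures that the next one, found beyond `max T`,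
  -- is new.
  suffices h : ∃ S : Finset ℝ, T.card ≤ S.card + 1 ∧
      ∀ x ∈ S, (x ∈ Ioo a b ∧ g' x = 0) ∧ ∃ t ∈ T, x < t by
    obtain ⟨S, h1, h2⟩ := h
    exact ⟨S, h1, fun x hx => (h2 x hx).1⟩
  induction T using Finset.induction_on_max with
  | empty => exact ⟨∅, by simp⟩
  | insert d T hd ih =>
    obtain ⟨S, hS, hS'⟩ := ih fun x hx => hT x (Finset.mem_insert_of_mem hx)
    have hdT : d ∉ T := fun h => lt_irrefl d (hd d h)
    rcases T.eq_empty_or_nonempty with rfl | hne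
    · exact ⟨∅, by simp⟩
    have hm := T.max'_mem hne
    set m := T.max' hne with hm_def
    obtain ⟨hmI, hm0⟩ := hT m (Finset.mem_insert_of_mem hm)
    obtain ⟨hdI, hd0⟩ := hT d (Finset.mem_insert_self d T)
    have hsub : Ioo m d ⊆ Ioo a b := Ioo_subset_Ioo hmI.1 hdI.2
    obtain ⟨e, he, he0⟩ := exists_hasDerivAt_eq_zero (hd m hm)
      (hg.mono (Icc_subset_Icc hmI.1 hdI.2)) (hm0.trans hd0.symm) fun x hx => hg' x (hsub hx)
    have heS : e ∉ S := fun h => by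
      obtain ⟨t, ht, het⟩ := (hS' e h).2
      exact absurd (het.trans_le (T.le_max' t ht)) he.1.not_gt
    refine ⟨insert e S, ?_, fun x hx => ?_⟩
    · rw [Finset.card_insert_of_notMem hdT, Finset.card_insert_of_notMem heS]
      omega
    · rcases Finset.mem_insert.1 hx with rfl | hx
      · exact ⟨⟨hsub he, he0⟩, d, Finset.mem_insert_self d T, he.2⟩
      · obtain ⟨h, t, ht, hxt⟩ := hS' x hx
        exact ⟨h, t, Finset.mem_insert_of_mem ht, hxt⟩

theorem nthDeriv_succ (j : ℕ) (a b : ℝ) (f : ℝ → ℝ) :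
    nthDeriv (j + 1) a b f = derivWithin (nthDeriv j a b f) (Icc a b) :=
  iteratedDerivWithin_succ

namespace zeroClass

variable {n k : ℕ} {a b : ℝ} {f : ℝ → ℝ}

theorem continuousOn_nthDeriv (hf : zeroClass n k a b f) (hab : a < b) {j : ℕ} (hj : j ≤ n - 1) :
    ContinuousOn (nthDeriv j a b f) (Icc a b) :=
  hf.contDiffOn.continuousOn_iteratedDerivWithin (by exact_mod_cast hj) (uniqueDiffOn_Icc hab)

theorem differentiableOn_nthDeriv (hf : zeroClass n k a b f) (hab : a < b) {j : ℕ}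
    (hj : j < n - 1) : DifferentiableOn ℝ (nthDeriv j a b f) (Icc a b) :=
  hf.contDiffOn.differentiableOn_iteratedDerivWithin (by exact_mod_cast hj) (uniqueDiffOn_Icc hab)

/-- Going from order `j` to `j + 1`, the endpoint `a` adds a zero if `j < k`, the endpoint `b` if `j
< n - k`, and Rolle loses one. -/
theorem exists_finset_zeros (hf : zeroClass n k a b f) (hab : a < b) {j : ℕ} (hj : j ≤ n - 1) :
    ∃ S : Finset ℝ, min j k + min j (n - k) ≤ S.card + j ∧
      ∀ x ∈ S, x ∈ Ioo a b ∧ nthDeriv j a b f x = 0 := by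
  induction j with
  | zero => exact ⟨∅, by simp⟩
  | succ j ih =>
    obtain ⟨S, hS, hS0⟩ := ih (by omega)
    obtain ⟨T₁, hT₁, hT₁0⟩ : ∃ T : Finset ℝ, min (j + 1) k + min j (n - k) ≤ T.card + j ∧
        ∀ x ∈ T, x ∈ Ico a b ∧ nthDeriv j a b f x = 0 := by
      by_cases hjk : j < k
      · refine ⟨insert a S, ?_, fun x hx => ?_⟩
        · rw [Finset.card_insert_of_notMem fun h => lt_irrefl a (hS0 a h).1.1]
          omega
        · rcases Finset.mem_insert.1 hx with rfl | hx
          · exact ⟨left_mem_Ico.2 hab, hf.zero_left j hjk⟩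
          · exact ⟨Ioo_subset_Ico_self (hS0 x hx).1, (hS0 x hx).2⟩
      · exact ⟨S, by omega, fun x hx => ⟨Ioo_subset_Ico_self (hS0 x hx).1, (hS0 x hx).2⟩⟩
    obtain ⟨T₂, hT₂, hT₂0⟩ : ∃ T : Finset ℝ,
        min (j + 1) k + min (j + 1) (n - k) ≤ T.card + j ∧
        ∀ x ∈ T, x ∈ Icc a b ∧ nthDeriv j a b f x = 0 := by
      by_cases hjk : j < n - k
      · refine ⟨insert b T₁, ?_, fun x hx => ?_⟩
        · rw [Finset.card_insert_of_notMem fun h => lt_irrefl b (hT₁0 b h).1.2]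
          omega
        · rcases Finset.mem_insert.1 hx with rfl | hx
          · exact ⟨right_mem_Icc.2 hab.le, hf.zero_right j hjk⟩
          · exact ⟨Ico_subset_Icc_self (hT₁0 x hx).1, (hT₁0 x hx).2⟩
      · exact ⟨T₁, by omega, fun x hx => ⟨Ico_subset_Icc_self (hT₁0 x hx).1, (hT₁0 x hx).2⟩⟩
    have hderiv : ∀ x ∈ Ioo a b,
        HasDerivAt (nthDeriv j a b f) (nthDeriv (j + 1) a b f x) x := fun x hx => by
      rw [nthDeriv_succ]
      exact (hf.differentiableOn_nthDeriv hab (by omega) x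
        (Ioo_subset_Icc_self hx)).hasDerivWithinAt.hasDerivAt (Icc_mem_nhds hx.1 hx.2)
    obtain ⟨S', hS', hS'0⟩ := exists_finset_zeros_deriv
      (hf.continuousOn_nthDeriv hab (by omega)) hderiv T₂ hT₂0
    exact ⟨S', by omega, hS'0⟩

theorem exists_nthDeriv_eq_zero (hf : zeroClass n k a b f) (hab : a < b) (hk : k ≤ n) {j : ℕ}
    (hj : j < n) : ∃ z ∈ Icc a b, nthDeriv j a b f z = 0 := by
  by_cases h1 : j < k
  · exact ⟨a, left_mem_Icc.2 hab.le, hf.zero_left j h1⟩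
  by_cases h2 : j < n - k
  · exact ⟨b, right_mem_Icc.2 hab.le, hf.zero_right j h2⟩
  -- Now `k ≤ j` and `n - k ≤ j`, so at least `n - j > 0` interior zeros remain.
  obtain ⟨S, hS, hS0⟩ := hf.exists_finset_zeros hab (j := j) (by omega)
  obtain ⟨z, hz⟩ : S.Nonempty := by
    rw [← Finset.card_pos]
    omega
  exact ⟨z, Ioo_subset_Icc_self (hS0 z hz).1, (hS0 z hz).2⟩

theorem nthDeriv_eqOn (hn : 1 ≤ n) (f : ℝ → ℝ) :
    EqOn (nthDeriv n a b f) (deriv (nthDeriv (n - 1) a b f)) (Ioo a b) := fun x hx => by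
  obtain ⟨m, rfl⟩ := Nat.exists_eq_add_of_le' hn
  rw [nthDeriv_succ]
  exact derivWithin_of_mem_nhds (Icc_mem_nhds hx.1 hx.2)

theorem integrableOn_nthDeriv (hf : zeroClass n k a b f) (hab : a < b) (hn : 1 ≤ n) :
    IntegrableOn (nthDeriv n a b f) (Ioo a b) := by
  rw [integrableOn_congr_fun (nthDeriv_eqOn hn f) measurableSet_Ioo]
  exact (intervalIntegrable_iff_integrableOn_Ioo_of_le hab.le).1 hf.absCont.intervalIntegrable_deriv

theorem abs_nthDeriv_pred_le (hf : zeroClass n k a b f) (hab : a < b) (hn : 1 ≤ n) (hk : k ≤ n)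
    {x : ℝ} (hx : x ∈ Icc a b) :
    |nthDeriv (n - 1) a b f x| ≤ ∫ t in Ioo a b, |nthDeriv n a b f t| := by
  obtain ⟨z, hz, hz0⟩ := hf.exists_nthDeriv_eq_zero hab hk (j := n - 1) (by omega)
  have hsub : uIcc z x ⊆ uIcc a b := by
    rw [uIcc_of_le hab.le]
    exact uIcc_subset_Icc hz hx
  have hFTC := (hf.absCont.mono hsub).integral_deriv_eq_sub
  rw [hz0, sub_zero] at hFTC
  have hint : IntegrableOn (fun t => |deriv (nthDeriv (n - 1) a b f) t|) (Ioc a b) := by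
    have := hf.absCont.intervalIntegrable_deriv
    rw [intervalIntegrable_iff_integrableOn_Ioc_of_le hab.le] at this
    exact this.abs
  calc |nthDeriv (n - 1) a b f x|
      ≤ ∫ t in uIoc z x, |deriv (nthDeriv (n - 1) a b f) t| := by
        rw [← hFTC]
        exact intervalIntegral.norm_integral_le_integral_norm_uIoc (E := ℝ)
    _ ≤ ∫ t in Ioc a b, |deriv (nthDeriv (n - 1) a b f) t| := by
        refine setIntegral_mono_set hint (.of_forall fun t => abs_nonneg _)
          (LE.le.eventuallyLE ?_)
        exact Ioc_subset_Ioc (le_min hz.1 hx.1) (max_le hz.2 hx.2)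
    _ = ∫ t in Ioo a b, |nthDeriv n a b f t| := by
        rw [integral_Ioc_eq_integral_Ioo]
        exact setIntegral_congr_fun measurableSet_Ioo fun t ht => by
          simp only [nthDeriv_eqOn hn f ht]

/-- On the unit interval the functions of the zero class are bounded by the `L¹` norm of their
`n`-th derivative. -/
theorem abs_le_integral (hf : zeroClass n k 0 1 f) (hn : 1 ≤ n) (hk : k ≤ n) {x : ℝ}
    (hx : x ∈ Icc (0 : ℝ) 1) : |f x| ≤ ∫ t in Ioo 0 1, |nthDeriv n 0 1 f t| := by
  set M := ∫ t in Ioo 0 1, |nthDeriv n 0 1 f t| with hM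
  have hM0 : 0 ≤ M := integral_nonneg fun t => abs_nonneg _
  -- Descending induction on the order: the mean value inequality from a zero costs a factor at most
  -- the interval length 1.
  have key : ∀ m ≤ n - 1, ∀ y ∈ Icc (0 : ℝ) 1, |nthDeriv (n - 1 - m) 0 1 f y| ≤ M := by
    intro m
    induction m with
    | zero => exact fun _ y hy => hf.abs_nthDeriv_pred_le one_pos hn hk hy
    | succ m ih =>
      intro hm y hy
      obtain ⟨z, hz, hz0⟩ := hf.exists_nthDeriv_eq_zero one_pos hk (j := n - 1 - (m + 1)) (by omega)
      have hsucc : n - 1 - m = n - 1 - (m + 1) + 1 := by omega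
      have h := (convex_Icc (0 : ℝ) 1).norm_image_sub_le_of_norm_derivWithin_le
        (hf.differentiableOn_nthDeriv one_pos (j := n - 1 - (m + 1)) (by omega))
        (C := M) (fun w hw => ?_) hz hy
      · rw [hz0, sub_zero, Real.norm_eq_abs, Real.norm_eq_abs] at h
        refine h.trans (mul_le_of_le_one_right hM0 ?_)
        rw [abs_le]
        constructor <;> linarith [hz.1, hz.2, hy.1, hy.2]
      · rw [← nthDeriv_succ, ← hsucc]
        exact ih (by omega) w hw
  simpa [nthDeriv] using key (n - 1) le_rfl x hx

end zeroClass

/-- The linear chain rule needs no differentiability: where it fails, both sides take the default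
value 0. -/
theorem nthDeriv_dilation (n : ℕ) {Δ : ℝ} (hΔ : 0 < Δ) (f : ℝ → ℝ) :
    nthDeriv n 0 Δ (dilation Δ f) = fun x => Δ⁻¹ ^ n * nthDeriv n 0 1 f (x / Δ) := by
  induction n with
  | zero => ext x; simp [nthDeriv, dilation]
  | succ n ih =>
    ext x
    have h := derivWithin_comp_mul_left Δ⁻¹ (nthDeriv n 0 1 f) (Icc 0 Δ) x
    rw [LinearOrderedField.smul_Icc (inv_pos.2 hΔ), mul_zero,
      inv_mul_cancel₀ hΔ.ne'] at h
    rw [nthDeriv_succ, nthDeriv_succ, ih, derivWithin_const_mul_field]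
    simp only [div_eq_inv_mul]
    rw [h, smul_eq_mul]
    ring

theorem integral_comp_div_Ioo {Δ : ℝ} (hΔ : 0 < Δ) (g : ℝ → ℝ) :
    ∫ x in Ioo 0 Δ, g (x / Δ) = Δ * ∫ x in Ioo 0 1, g x := by
  rw [← integral_Ioc_eq_integral_Ioo, ← integral_Ioc_eq_integral_Ioo,
    ← intervalIntegral.integral_of_le hΔ.le, ← intervalIntegral.integral_of_le zero_le_one,
    intervalIntegral.integral_comp_div g hΔ.ne', zero_div, div_self hΔ.ne', smul_eq_mul]

theorem integrableOn_comp_div_Ioo {Δ : ℝ} (hΔ : 0 < Δ) {g : ℝ → ℝ} (hg : IntegrableOn g (Ioo 0 1)) :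
    IntegrableOn (fun x => g (x / Δ)) (Ioo 0 Δ) := by
  rw [← intervalIntegrable_iff_integrableOn_Ioo_of_le hΔ.le]
  have := ((intervalIntegrable_iff_integrableOn_Ioo_of_le zero_le_one).2 hg).comp_mul_right (c := Δ⁻¹)
  simpa [div_eq_mul_inv] using this

/-- The normalized Wirtinger inequality, valid with constant `1` for all Orlicz functions. -/
theorem normalizedNorm_dilation_le {Φ Ψ : ℝ → ℝ} (hΦ : IsOrliczFunction Φ)
    (hΨ : IsOrliczFunction Ψ) {n k : ℕ} (hn : 1 ≤ n) (hk : k ≤ n) {Δ : ℝ} (hΔ : 0 < Δ) {f : ℝ → ℝ}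
    (hf : zeroClass n k 0 1 f) :
    normalizedNorm Φ Δ (dilation Δ f) ≤
      ENNReal.ofReal (Δ ^ n) * normalizedNorm Ψ Δ (nthDeriv n 0 Δ (dilation Δ f)) := by
  set M := ∫ t in Ioo 0 1, |nthDeriv n 0 1 f t| with hM
  have hM0 : 0 ≤ M := integral_nonneg fun t => abs_nonneg _
  have hint : IntegrableOn (nthDeriv n 0 Δ (dilation Δ f)) (Ioo 0 Δ) := by
    rw [nthDeriv_dilation n hΔ]
    exact (integrableOn_comp_div_Ioo hΔ (hf.integrableOn_nthDeriv one_pos hn)).const_mul _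
  -- `Δ^n` cancels the chain-rule factor and `Δ⁻¹` the Jacobian.
  have hmean : Δ ^ n * (Δ⁻¹ * ∫ x in Ioo 0 Δ, |nthDeriv n 0 Δ (dilation Δ f) x|) = M := by
    simp_rw [nthDeriv_dilation n hΔ, abs_mul, integral_const_mul]
    rw [integral_comp_div_Ioo hΔ fun x => |nthDeriv n 0 1 f x|, ← hM, abs_of_pos (by positivity), inv_pow]
    field_simp
  calc normalizedNorm Φ Δ (dilation Δ f) ≤ ENNReal.ofReal M :=
        hΦ.normalizedNorm_le_of_abs_le hM0 fun x hx => hf.abs_le_integral hn hk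
          ⟨div_nonneg hx.1.le hΔ.le, (div_le_one hΔ).2 hx.2.le⟩
    _ = ENNReal.ofReal (Δ ^ n) *
          ENNReal.ofReal (Δ⁻¹ * ∫ x in Ioo 0 Δ, |nthDeriv n 0 Δ (dilation Δ f) x|) := by
        rw [← ENNReal.ofReal_mul (by positivity), hmean]
    _ ≤ _ := by
        gcongr
        exact hΨ.average_le_normalizedNorm hΔ hint

end Wirtinger

theorem theorem5p1 (p q γ β : ℝ) (hp : 1 < p) (hq : 1 ≤ q) (hγ : 0 ≤ γ) (hβ : 0 ≤ β)
    (n k : ℕ) (hn : 1 ≤ n) (hk : k ≤ n) :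
    -- the generating functions are Orlicz functions once the constants are large enough
    (∃ c₀ : ℝ, 1 < c₀ ∧ ∀ c : ℝ, c₀ ≤ c →
      Wirtinger.IsOrliczFunction (Wirtinger.zygmund q γ c) ∧
      Wirtinger.IsOrliczFunction (Wirtinger.zygmund p (-β) c)) ∧
    -- for all such constants the Wirtinger functional is bounded uniformly in the dilation
    ∀ cX cY : ℝ, 1 < cX → 1 < cY →
      Wirtinger.IsOrliczFunction (Wirtinger.zygmund q γ cX) →
      Wirtinger.IsOrliczFunction (Wirtinger.zygmund p (-β) cY) →
      (⨆ (Δ : ℝ) (_ : 0 < Δ),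
        Wirtinger.wirtingerFunctional (Wirtinger.zygmund q γ cX)
          (Wirtinger.zygmund p (-β) cY) n k Δ) < ∞ ∧
      ∃ C : ℝ≥0, ∀ Δ : ℝ, 0 < Δ → ∀ f : ℝ → ℝ, Wirtinger.zeroClass n k 0 1 f →
        Wirtinger.normalizedNorm (Wirtinger.zygmund q γ cX) Δ (Wirtinger.dilation Δ f) ≤
          C * (ENNReal.ofReal (Δ ^ n) *
            Wirtinger.normalizedNorm (Wirtinger.zygmund p (-β) cY) Δ
              (Wirtinger.nthDeriv n 0 Δ (Wirtinger.dilation Δ f))) := by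
  refine ⟨⟨max (Real.exp 1) (Real.exp (2 * β / (p - 1))),
    lt_max_of_lt_left (Real.one_lt_exp_iff.2 one_pos), fun c hc => ?_⟩,
    fun cX cY _ _ hX hY => ⟨?_, 1, fun Δ hΔ f hf => ?_⟩⟩
  · have hc1 := (le_max_left _ _).trans hc
    exact ⟨Wirtinger.isOrliczFunction_zygmund_of_nonneg hq hγ hc1,
      Wirtinger.isOrliczFunction_zygmund_neg hp hβ
        ((Real.one_lt_exp_iff.2 one_pos).trans_le hc1) ((le_max_right _ _).trans hc)⟩
  · refine lt_of_le_of_lt (iSup₂_le fun Δ hΔ => iSup₂_le fun f hf => iSup_le fun _ => ?_)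
      ENNReal.one_lt_top
    -- Also valid for denominator 0 or `∞`, as `0 / 0 = 0` and `x / ∞ = 0`.
    refine ENNReal.div_le_of_le_mul ?_
    rw [one_mul]
    exact Wirtinger.normalizedNorm_dilation_le hX hY hn hk hΔ hf
  · rw [ENNReal.coe_one, one_mul]
    exact Wirtinger.normalizedNorm_dilation_le hX hY hn hk hΔ hf
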